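/- Theorem 1.1. There exists a metric space $(X,d)$ with all of the following properties. 1. $X$ is uniformly discrete: there is $\delta>0$ such that $d(x,y)\ge\delta$ for all $x\ne y$ in $X$. 2. $X$ has bounded geometry: for every $R\ge 0$ there is $N\in\mathbb{N}$ such that for every $x\in X$ the closed ball of radius $R$ about $x$ has at most $N$ elements. 3. $X$ coarsely embeds into a Hilbert space: there are a Hilbert space $\mathcal{H}$ and a map $f\colon X\to\mathcal{H}$ such that for all sequences $(x_n)_{n\in\mathbb{N}}$, $(y_n)_{n\in\mathbb{N}}$ in $X$, $$d(x_n,y_n)\to\infty \iff \|f(x_n)-f(y_n)\|\to\infty .$$ 4. $X$ does not have property A. Here $X$ is said to have property A if for every $\varepsilon>0$ and every $R>0$ there are a family $(A_x)_{x\in X}$ of finite subsets of $X\times\mathbb{N}$ and a number $S>0$ such that $A_x\cap A_y\neq\emptyset$ and $$\frac{|A_x\bigtriangleup A_y|}{|A_x\cap A_y|}<\varepsilon\quad\text{whenever } d(x,y)\le R,$$ and $A_x\subseteq\{z\in X : d(z,x)\le S\}\times\mathbb{N}$ for every $x\in X$. -/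

import Mathlib

open Filter

/-- Any two distinct points are at distance at least some fixed `δ > 0`. -/
def UniformlyDiscrete (X : Type*) [MetricSpace X] : Prop :=
  ∃ δ : ℝ, 0 < δ ∧ ∀ x y : X, x ≠ y → δ ≤ dist x y

/-- Bounded geometry of a (uniformly discrete) metric space: for every radius, the number of
points in balls of that radius is finite and bounded uniformly in the centre. -/
def BoundedGeometry (X : Type*) [MetricSpace X] : Prop :=
  ∀ R : ℝ, ∃ N : ℕ, ∀ x : X,
    (Metric.closedBall x R).Finite ∧ (Metric.closedBall x R).ncard ≤ N

/-- For all sequences `x n`, `y n` of points of `X`, the distances `dist (x n) (y n)` tend to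
infinity if and only if the distances of the images do. -/
def IsCoarseEmbedding {X H : Type*} [MetricSpace X] [NormedAddCommGroup H] (f : X → H) : Prop :=
  ∀ x y : ℕ → X,
    Tendsto (fun n => dist (x n) (y n)) atTop atTop ↔
      Tendsto (fun n => ‖f (x n) - f (y n)‖) atTop atTop

/-- `X` admits a coarse embedding into some Hilbert space. -/
def CoarselyEmbedsIntoHilbert.{u} (X : Type u) [MetricSpace X] : Prop :=
  ∃ (H : Type u) (_ : NormedAddCommGroup H) (_ : InnerProductSpace ℝ H) (_ : CompleteSpace H)
    (f : X → H), IsCoarseEmbedding f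

open Classical in
/-- Yu's property A. The condition `|A x ∆ A y| / |A x ∩ A y| < ε` is written without division,
so that it entails `A x ∩ A y ≠ ∅`; in particular every `A x` is nonempty. -/
def PropertyA (X : Type*) [MetricSpace X] : Prop :=
  ∀ ε : ℝ, 0 < ε → ∀ R : ℝ, 0 < R →
    ∃ (A : X → Finset (X × ℕ)) (S : ℝ), 0 < S ∧
      (∀ x y : X, dist x y ≤ R →
        ((symmDiff (A x) (A y)).card : ℝ) < ε * ((A x ∩ A y).card : ℝ)) ∧
      (∀ x : X, ∀ p ∈ A x, dist p.1 x ≤ S)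

/-! The space is a disjoint union of mod 2 homology covers of finite cubic graphs $G_n$ whose
nonzero mod 2 cycles have more than $n$ edges. A point of a cover is a vertex with a mod 2 chain,
and crossing a lift of an edge $e$ flips the coordinate $e$. So every edge of $G_n$ gives a wall,
and the points of the cover map to a Hilbert space by the indicators of their walls.

Wall distance never exceeds graph distance. Conversely, the chains of two points in one component
differ by a chain bounded by their projections; if it has fewer edges than the girth, it is a path,
which lifts to a walk of that length (`exists_walk_of_hammingNorm_lt`). Thus the two distances agree
below the girth, which tends to infinity, and the embedding is coarse.

The cover doubles the girth (`CycleGirth.homologyCover`): the projected support of a cycle has no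
leaves, so contains a cycle, and every fibre over an edge is even. Iterating from $K_4$ supplies the
$G_n$.

Cubic graphs of large girth are locally trees. Property A would let each vertex distribute mass at
most 1 among its neighbours, while nearly 1 in total must cross each edge. With 3/2 edges per vertex
this is impossible (`SizedGraph.not_propertyA`). -/

section Chains
open scoped Classical
open SimpleGraph

variable {V : Type*}

/-! ### Mod 2 chains and the homology cover -/

theorem zmod_two_eq_one {a : ZMod 2} (h : a ≠ 0) : a = 1 := by
  revert a; decide

theorem pi_zmod_two_add_self {ι : Type*} (f : ι → ZMod 2) : f + f = 0 := by
  ext i; exact CharTwo.add_self_eq_zero (f i)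

/-- A chain is carried by the edges of `G`. -/
def ChainOn (G : SimpleGraph V) (z : Sym2 V → ZMod 2) : Prop :=
  ∀ e, z e ≠ 0 → e ∈ G.edgeSet

theorem ChainOn.add {G : SimpleGraph V} {z w : Sym2 V → ZMod 2} (hz : ChainOn G z)
    (hw : ChainOn G w) : ChainOn G (z + w) := by
  intro e he
  by_cases h : z e = 0
  · exact hw e fun h' => he (by simp [h, h'])
  · exact hz e h

theorem chainOn_single {G : SimpleGraph V} {a b : V} (h : G.Adj a b) :
    ChainOn G (Pi.single s(a, b) 1) := by
  intro e he
  by_cases h' : e = s(a, b)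
  · subst h'; exact h
  · simp [Pi.single_eq_of_ne h'] at he

/-- The mod 2 homology cover of `G` (a disjoint union of copies of it). -/
noncomputable def homologyCover (G : SimpleGraph V) : SimpleGraph (V × (Sym2 V → ZMod 2)) where
  Adj x y := G.Adj x.1 y.1 ∧ y.2 = x.2 + Pi.single s(x.1, y.1) 1
  symm := ⟨fun x y h => ⟨h.1.symm, by
    rw [h.2, add_assoc, Sym2.eq_swap, pi_zmod_two_add_self, add_zero]⟩⟩
  loopless := ⟨fun x h => G.loopless.irrefl _ h.1⟩

theorem homologyCover_adj {G : SimpleGraph V} {x y : V × (Sym2 V → ZMod 2)} :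
    (homologyCover G).Adj x y ↔ G.Adj x.1 y.1 ∧ y.2 = x.2 + Pi.single s(x.1, y.1) 1 := Iff.rfl

theorem homologyCover_neighborSet (G : SimpleGraph V) (x : V × (Sym2 V → ZMod 2)) :
    (homologyCover G).neighborSet x =
      (fun w => (w, x.2 + Pi.single s(x.1, w) 1)) '' G.neighborSet x.1 := by
  ext ⟨w, d⟩
  simp only [mem_neighborSet, homologyCover_adj, Set.mem_image, Prod.mk.injEq]
  constructor
  · rintro ⟨h, rfl⟩; exact ⟨w, h, rfl, rfl⟩
  · rintro ⟨_, h, rfl, rfl⟩; exact ⟨h, rfl⟩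

theorem ncard_neighborSet_homologyCover (G : SimpleGraph V) (x : V × (Sym2 V → ZMod 2)) :
    ((homologyCover G).neighborSet x).ncard = (G.neighborSet x.1).ncard := by
  rw [homologyCover_neighborSet]
  exact Set.ncard_image_of_injective _ fun a b h => (Prod.ext_iff.1 h).1

variable [Fintype V]

/-- The boundary of a mod 2 chain of edges. -/
noncomputable def chainBoundary (V : Type*) [Fintype V] :
    (Sym2 V → ZMod 2) →ₗ[ZMod 2] (V → ZMod 2) where
  toFun z v := ∑ e, if v ∈ e then z e else 0
  map_add' z w := by
    ext v
    simp only [Pi.add_apply, ← Finset.sum_add_distrib]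
    exact Finset.sum_congr rfl fun e _ => by split_ifs <;> simp
  map_smul' r z := by
    ext v
    simp [Finset.mul_sum]

theorem chainBoundary_apply (z : Sym2 V → ZMod 2) (v : V) :
    chainBoundary V z v = ∑ e, if v ∈ e then z e else 0 := rfl

theorem sum_mem_sym2 {M : Type*} [AddCommMonoid M] {a b : V} (h : a ≠ b) (φ : V → M) :
    (∑ u, if u ∈ s(a, b) then φ u else 0) = φ a + φ b := by
  rw [← Finset.sum_filter, ← Finset.sum_pair h]
  congr 1
  ext u
  simp

/-- Boundary and coboundary are adjoint. Constant `φ` shows that a boundary has even total; a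
coordinate of the cover as `φ` shows that cycles meet cuts evenly. -/
theorem sum_mul_chainBoundary (φ : V → ZMod 2) (z : Sym2 V → ZMod 2) :
    ∑ u, φ u * chainBoundary V z u = ∑ e, z e * ∑ u, if u ∈ e then φ u else 0 := by
  simp only [chainBoundary_apply, Finset.mul_sum]
  rw [Finset.sum_comm]
  refine Finset.sum_congr rfl fun e _ => Finset.sum_congr rfl fun u _ => ?_
  split_ifs <;> ring

theorem chainBoundary_single {a b : V} (h : a ≠ b) :
    chainBoundary V (Pi.single s(a, b) 1) = Pi.single a 1 + Pi.single b 1 := by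
  ext v
  rw [chainBoundary_apply, Finset.sum_eq_single s(a, b)]
  · by_cases ha : v = a
    · subst ha; simp [h]
    · by_cases hb : v = b
      · subst hb; simp [ha]
      · simp [ha, hb]
  · intro e _ he
    simp [Pi.single_eq_of_ne he]
  · simp

/-- Every nonzero mod 2 cycle of `G` has at least `g` edges. -/
def CycleGirth (G : SimpleGraph V) (g : ℕ) : Prop :=
  ∀ z : Sym2 V → ZMod 2, ChainOn G z → z ≠ 0 → chainBoundary V z = 0 → g ≤ hammingNorm z

/-- A nonempty finite set of edges without leaves carries a nonzero cycle. -/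
theorem exists_cycle_of_leafless (D : Finset (Sym2 V)) (hD : D.Nonempty)
    (hdiag : ∀ e ∈ D, ¬ e.IsDiag) (hleaf : ∀ v, (D.filter (v ∈ ·)).card ≠ 1) :
    ∃ z : Sym2 V → ZMod 2, z ≠ 0 ∧ (∀ e, z e ≠ 0 → e ∈ D) ∧ chainBoundary V z = 0 := by
  set Vs : Finset V := Finset.univ.filter fun v => ∃ e ∈ D, v ∈ e with hVs
  have hand : ∑ v ∈ Vs, (D.filter (v ∈ ·)).card = 2 * D.card := by
    have h1 : ∑ v ∈ Vs, (D.filter (v ∈ ·)).card = ∑ v : V, (D.filter (v ∈ ·)).card := by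
      refine Finset.sum_subset (Finset.subset_univ _) fun v _ hv => ?_
      simp only [Finset.card_eq_zero, Finset.filter_eq_empty_iff]
      intro e he hve
      exact hv (by simp only [hVs, Finset.mem_filter, Finset.mem_univ, true_and]; exact ⟨e, he, hve⟩)
    rw [h1]
    simp only [Finset.card_filter]
    rw [Finset.sum_comm, mul_comm, ← smul_eq_mul, ← Finset.sum_const]
    refine Finset.sum_congr rfl fun e he => ?_
    induction e with
    | _ a b => exact sum_mem_sym2 (by simpa using hdiag _ he) (fun _ => 1)
  -- All degrees are at least 2, so the handshake count leaves at least as many edges as vertices.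
  have hcard : Vs.card ≤ D.card := by
    have : ∑ v ∈ Vs, 2 ≤ ∑ v ∈ Vs, (D.filter (v ∈ ·)).card := by
      refine Finset.sum_le_sum fun v hv => ?_
      have h1 := hleaf v
      have h2 : 0 < (D.filter (v ∈ ·)).card := by
        obtain ⟨e, he, hve⟩ := (Finset.mem_filter.1 hv).2
        exact Finset.card_pos.2 ⟨e, Finset.mem_filter.2 ⟨he, hve⟩⟩
      omega
    rw [hand, Finset.sum_const, smul_eq_mul] at this
    omega
  obtain ⟨v₀, hv₀⟩ : Vs.Nonempty := by
    obtain ⟨e, he⟩ := hD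
    induction e with
    | _ a b => exact ⟨a, by simp only [hVs, Finset.mem_filter, Finset.mem_univ, true_and]
                            exact ⟨_, he, by simp⟩⟩
  let ext : (D → ZMod 2) →ₗ[ZMod 2] (Sym2 V → ZMod 2) :=
    { toFun := fun y e => if h : e ∈ D then y ⟨e, h⟩ else 0
      map_add' := fun y y' => by ext e; by_cases h : e ∈ D <;> simp [h]
      map_smul' := fun r y => by ext e; by_cases h : e ∈ D <;> simp [h] }
  -- The condition at `v₀` is dropped because it follows from the others by parity. This leaves
  -- strictly fewer equations than unknowns.
  let F : (D → ZMod 2) →ₗ[ZMod 2] ({v // v ∈ Vs.erase v₀} → ZMod 2) :=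
    (LinearMap.funLeft (ZMod 2) (ZMod 2) Subtype.val) ∘ₗ
      chainBoundary V ∘ₗ ext
  have hF : LinearMap.ker F ≠ ⊥ := by
    apply LinearMap.ker_ne_bot_of_finrank_lt
    have := Finset.card_pos.2 ⟨v₀, hv₀⟩
    simp only [Module.finrank_fintype_fun_eq_card, Fintype.card_coe, Finset.card_erase_of_mem hv₀]
    omega
  obtain ⟨y, hy, hy0⟩ := (Submodule.ne_bot_iff _).1 hF
  have hsupp : ∀ e, ext y e ≠ 0 → e ∈ D := fun e he => by
    by_contra h
    exact he (dif_neg h)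
  have hoff : ∀ v, v ≠ v₀ → chainBoundary V (ext y) v = 0 := by
    intro v hv
    by_cases hvs : v ∈ Vs
    · exact congrFun (LinearMap.mem_ker.1 hy) ⟨v, Finset.mem_erase.2 ⟨hv, hvs⟩⟩
    · rw [chainBoundary_apply]
      refine Finset.sum_eq_zero fun e _ => ?_
      split_ifs with hve
      · by_contra h
        exact hvs (Finset.mem_filter.2 ⟨Finset.mem_univ _, e, hsupp e h, hve⟩)
      · rfl
  refine ⟨ext y, ?_, hsupp, ?_⟩
  · intro h
    apply hy0
    ext ⟨e, he⟩
    have := congrFun h e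
    simpa [ext, he] using this
  · ext v
    by_cases hv : v = v₀
    · subst hv
      have h := sum_mul_chainBoundary (fun _ => 1) (ext y)
      rw [Finset.sum_eq_single v (fun u _ hu => by rw [hoff u hu, mul_zero]) (by simp)] at h
      rw [one_mul] at h
      rw [h]
      refine Finset.sum_eq_zero fun e _ => ?_
      by_cases hz : ext y e = 0
      · simp [hz]
      · have := hdiag e (hsupp e hz)
        induction e with
        | _ a b =>
          rw [sum_mem_sym2 (by simpa using this) (fun _ => (1 : ZMod 2))]
          exact mul_eq_zero_of_right _ (by decide)
    · exact hoff v hv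

/-- Every fibre of a cycle of the homology cover over an edge of the base has even size, since
it is the intersection of the cycle with a cut. -/
theorem sum_fiber_eq_zero {G : SimpleGraph V} {z : Sym2 (V × (Sym2 V → ZMod 2)) → ZMod 2}
    (hz : ChainOn (homologyCover G) z) (hb : chainBoundary _ z = 0) (e : Sym2 V) :
    (∑ e', if Sym2.map Prod.fst e' = e then z e' else 0) = 0 := by
  -- Coordinate `e` changes exactly along the lifts of `e`, which therefore form a cut.
  have h := sum_mul_chainBoundary (fun u : V × (Sym2 V → ZMod 2) => u.2 e) z
  simp only [hb, Pi.zero_apply, mul_zero, Finset.sum_const_zero] at h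
  refine Eq.trans (Finset.sum_congr rfl fun e' _ => ?_) h.symm
  by_cases h0 : z e' = 0
  · simp [h0]
  · have hadj := hz e' h0
    induction e' with
    | _ a b =>
      rw [mem_edgeSet] at hadj
      rw [sum_mem_sym2 hadj.ne (fun u : V × (Sym2 V → ZMod 2) => u.2 e), (homologyCover_adj.1 hadj).2]
      rw [Pi.add_apply, ← add_assoc, CharTwo.add_self_eq_zero, zero_add, Sym2.map_mk, Pi.single_apply]
      by_cases h1 : e = s(a.1, b.1)
      · simp [h1]
      · simp [h1, Ne.symm h1]

theorem exists_ne_of_sum_eq_zero {ι : Type*} [Fintype ι] {p : ι → Prop} [DecidablePred p] {z : ι → ZMod 2}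
    (h : (∑ i, if p i then z i else 0) = 0) {i : ι} (hi : p i) (hz : z i ≠ 0) :
    ∃ j, j ≠ i ∧ p j ∧ z j ≠ 0 := by
  by_contra hcon
  push Not at hcon
  rw [Finset.sum_eq_single i] at h
  · simp [hi, hz] at h
  · intro j _ hj
    split_ifs with hp
    · exact hcon j hj hp
    · rfl
  · simp

/-- Passing to the homology cover doubles the girth. -/
theorem CycleGirth.homologyCover {G : SimpleGraph V} {g : ℕ} (hg : CycleGirth G g) :
    CycleGirth (homologyCover G) (2 * g) := by
  intro z hz hz0 hb
  set S : Finset (Sym2 (V × (Sym2 V → ZMod 2))) := Finset.univ.filter fun e => z e ≠ 0 with hS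
  have memS : ∀ e, e ∈ S ↔ z e ≠ 0 := fun e => by simp [hS]
  set D : Finset (Sym2 V) := S.image (Sym2.map Prod.fst) with hD
  have hDG : ∀ e ∈ D, e ∈ G.edgeSet := by
    intro e he
    obtain ⟨e', he', rfl⟩ := Finset.mem_image.1 he
    have := hz e' ((memS _).1 he')
    induction e' with
    | _ a b => exact (homologyCover_adj.1 this).1
  have hDne : D.Nonempty := by
    obtain ⟨e, he⟩ := Function.ne_iff.1 hz0
    exact ⟨_, Finset.mem_image_of_mem _ ((memS e).2 he)⟩
  -- A cycle has a second edge at any vertex it meets, and the covering is injective on the edges at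
  -- a vertex, so the projections differ.
  have hleaf : ∀ v, (D.filter (v ∈ ·)).card ≠ 1 := by
    intro v hv
    obtain ⟨e, he⟩ := Finset.card_eq_one.1 hv
    have he1 : e ∈ D.filter (v ∈ ·) := by rw [he]; simp
    obtain ⟨heD, hve⟩ := Finset.mem_filter.1 he1
    obtain ⟨e', he', rfl⟩ := Finset.mem_image.1 heD
    obtain ⟨x, hx, rfl⟩ := Sym2.mem_map.1 hve
    have hbx : (∑ e, if x ∈ e then z e else 0) = 0 := by
      have := congrFun hb x
      rw [chainBoundary_apply, Pi.zero_apply] at this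
      convert this
    obtain ⟨e₂, hne, hx₂, hz₂⟩ :=
      exists_ne_of_sum_eq_zero (p := (x ∈ ·)) hbx hx ((memS _).1 he')
    have h₂ : Sym2.map Prod.fst e₂ ∈ D.filter (x.1 ∈ ·) :=
      Finset.mem_filter.2 ⟨Finset.mem_image_of_mem _ ((memS _).2 hz₂), Sym2.mem_map.2 ⟨x, hx₂, rfl⟩⟩
    rw [he, Finset.mem_singleton] at h₂
    obtain ⟨y, rfl⟩ := Sym2.mem_iff_exists.1 hx
    obtain ⟨y₂, rfl⟩ := Sym2.mem_iff_exists.1 hx₂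
    have a1 := homologyCover_adj.1 (hz _ ((memS _).1 he'))
    have a2 := homologyCover_adj.1 (hz _ hz₂)
    rw [Sym2.map_mk, Sym2.map_mk, Sym2.congr_right] at h₂
    apply hne
    congr 1
    exact Prod.ext h₂ (by rw [a1.2, a2.2, h₂])
  obtain ⟨w, hw0, hwD, hwb⟩ := exists_cycle_of_leafless D hDne
    (fun e he => G.not_isDiag_of_mem_edgeSet (hDG e he)) hleaf
  have h1 : g ≤ D.card := (hg w (fun e he => hDG e (hwD e he)) hw0 hwb).trans
    (Finset.card_le_card fun e he => hwD e (by simpa using he))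
  have h2 : 2 * D.card ≤ S.card := by
    refine Finset.mul_card_image_le_card _ _ fun e he => ?_
    obtain ⟨e', he', rfl⟩ := Finset.mem_image.1 he
    obtain ⟨e₂, hne, hp, hz₂⟩ := exists_ne_of_sum_eq_zero (p := fun e => Sym2.map Prod.fst e = Sym2.map Prod.fst e')
      (sum_fiber_eq_zero hz hb _) rfl
      ((memS _).1 he')
    exact Finset.one_lt_card.2 ⟨e', Finset.mem_filter.2 ⟨he', rfl⟩, e₂,
      Finset.mem_filter.2 ⟨(memS _).2 hz₂, hp⟩, hne.symm⟩
  calc 2 * g ≤ 2 * D.card := by omega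
    _ ≤ S.card := h2
    _ = hammingNorm z := rfl

/-! ### Walks of the cover and chains of the base -/

theorem hammingDist_le_length {G : SimpleGraph V} {x y : V × (Sym2 V → ZMod 2)}
    (p : (homologyCover G).Walk x y) : hammingDist x.2 y.2 ≤ p.length := by
  induction p with
  | nil => simp
  | @cons u v w h p ih =>
    have h1 : hammingDist u.2 v.2 ≤ 1 := by
      rw [(homologyCover_adj.1 h).2]
      refine (Finset.card_le_card (t := {s(u.1, v.1)}) fun e he => ?_).trans (by simp)
      by_contra hne
      simp [Pi.single_eq_of_ne (Finset.mem_singleton.not.1 hne)] at he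
    have := hammingDist_triangle u.2 v.2 w.2
    rw [Walk.length_cons]
    omega

/-- The chain difference is the projected walk counted mod 2, so its boundary is the pair of
projected ends. -/
theorem chain_of_walk {G : SimpleGraph V} {x y : V × (Sym2 V → ZMod 2)}
    (p : (homologyCover G).Walk x y) : ChainOn G (x.2 + y.2) ∧
      chainBoundary V (x.2 + y.2) = Pi.single x.1 1 + Pi.single y.1 1 := by
  induction p with
  | nil => simp only [pi_zmod_two_add_self, map_zero, and_true]; exact fun e he => absurd rfl he
  | @cons u v w h p ih =>
    obtain ⟨hadj, h2⟩ := homologyCover_adj.1 h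
    have hu : u.2 + w.2 = Pi.single s(u.1, v.1) 1 + (v.2 + w.2) := by
      rw [h2]
      have := pi_zmod_two_add_self (Pi.single s(u.1, v.1) 1 : Sym2 V → ZMod 2)
      linear_combination (exp := 1) -this
    rw [hu]
    refine ⟨(chainOn_single hadj).add ih.1, ?_⟩
    rw [map_add, ih.2, chainBoundary_single hadj.ne]
    have := pi_zmod_two_add_self (Pi.single v.1 1 : V → ZMod 2)
    linear_combination (exp := 1) this

/-- Two points of the homology cover whose chains differ by a short path of the base are joined by
a walk of the same length. -/
theorem exists_walk_of_hammingNorm_lt {G : SimpleGraph V} {g : ℕ} (hg : CycleGirth G g) (n : ℕ) :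
    ∀ (x y : V × (Sym2 V → ZMod 2)), ChainOn G (x.2 + y.2) →
      chainBoundary V (x.2 + y.2) = Pi.single x.1 1 + Pi.single y.1 1 →
      hammingNorm (x.2 + y.2) = n → n < g → ∃ p : (homologyCover G).Walk x y, p.length = n := by
  induction n with
  | zero =>
    intro x y _ hb hn _
    rw [hammingNorm_eq_zero] at hn
    rw [hn, map_zero] at hb
    have h1 : x.1 = y.1 := by
      by_contra hne
      have := congrFun hb x.1
      simp [hne] at this
    have h2 : x.2 = y.2 := by
      have := pi_zmod_two_add_self y.2
      linear_combination (exp := 1) hn - this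
    obtain rfl : x = y := Prod.ext h1 h2
    exact ⟨Walk.nil, rfl⟩
  | succ n ih =>
    intro x y hc hb hn hng
    have h0 : x.2 + y.2 ≠ 0 := by
      rw [← hammingNorm_ne_zero_iff]; omega
    -- Otherwise the difference is a nonzero cycle with fewer than `g` edges.
    have hne : x.1 ≠ y.1 := by
      intro h
      have := hg _ hc h0 (by rw [hb, h, pi_zmod_two_add_self])
      omega
    obtain ⟨e, hxe, hze⟩ : ∃ e, x.1 ∈ e ∧ (x.2 + y.2) e ≠ 0 := by
      by_contra hcon
      push Not at hcon
      have h1 : chainBoundary V (x.2 + y.2) x.1 = 0 := by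
        rw [chainBoundary_apply]
        refine Finset.sum_eq_zero fun e _ => ?_
        split_ifs with h
        · exact hcon e h
        · rfl
      rw [hb] at h1
      simp [hne] at h1
    obtain ⟨v, rfl⟩ := Sym2.mem_iff_exists.1 hxe
    have hadj : G.Adj x.1 v := hc _ hze
    -- Crossing an edge of the difference at `x.1` removes that edge from it.
    let x' : V × (Sym2 V → ZMod 2) := (v, x.2 + Pi.single s(x.1, v) 1)
    have hx' : (homologyCover G).Adj x x' := homologyCover_adj.2 ⟨hadj, rfl⟩
    have hadd : x'.2 + y.2 = Pi.single s(x.1, v) 1 + (x.2 + y.2) := by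
      simp only [x']; ring
    obtain ⟨p, hp⟩ := ih x' y (by rw [hadd]; exact (chainOn_single hadj).add hc)
      (by
        rw [hadd, map_add, hb, chainBoundary_single hadj.ne]
        have := pi_zmod_two_add_self (Pi.single x.1 1 : V → ZMod 2)
        simp only [x']
        linear_combination (exp := 1) this)
      (by
        rw [hadd]
        have : (Finset.univ.filter fun e => (Pi.single s(x.1, v) 1 + (x.2 + y.2) : Sym2 V → ZMod 2) e ≠ 0) =
            (Finset.univ.filter fun e => (x.2 + y.2) e ≠ 0).erase s(x.1, v) := by
          ext e
          simp only [Finset.mem_filter, Finset.mem_univ, true_and, Finset.mem_erase]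
          by_cases he : e = s(x.1, v)
          · subst he
            rw [Pi.add_apply, zmod_two_eq_one hze]
            simp
            decide
          · rw [Pi.add_apply, Pi.single_eq_of_ne he, zero_add]
            simp [he]
        unfold hammingNorm at hn ⊢
        rw [this, Finset.card_erase_of_mem (by simpa using hze), hn]
        rfl)
      (by omega)
    exact ⟨Walk.cons hx' p, by simp [hp]⟩

/-! ### Geodesics below the girth -/

theorem exists_chain_of_walk {G : SimpleGraph V} {x y : V} (p : G.Walk x y) :
    ∃ z : Sym2 V → ZMod 2, (∀ e, z e ≠ 0 → e ∈ p.edges) ∧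
      chainBoundary V z = Pi.single x 1 + Pi.single y 1 := by
  induction p with
  | nil => exact ⟨0, by simp, by rw [pi_zmod_two_add_self, map_zero]⟩
  | @cons u v w h p ih =>
    obtain ⟨z, hz, hb⟩ := ih
    refine ⟨Pi.single s(u, v) 1 + z, fun e he => ?_, ?_⟩
    · rw [Walk.edges_cons, List.mem_cons]
      by_cases h1 : e = s(u, v)
      · exact Or.inl h1
      · rw [Pi.add_apply, Pi.single_eq_of_ne h1, zero_add] at he
        exact Or.inr (hz e he)
    · rw [map_add, hb, chainBoundary_single h.ne]
      have := pi_zmod_two_add_self (Pi.single v 1 : V → ZMod 2)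
      linear_combination (exp := 1) this

/-- The ends of an edge are not joined by a short walk avoiding it. -/
theorem CycleGirth.le_length {G : SimpleGraph V} {g : ℕ} (hg : CycleGirth G g) {x y : V}
    (h : G.Adj x y) (p : G.Walk x y) (hp : s(x, y) ∉ p.edges) : g ≤ p.length + 1 := by
  obtain ⟨z, hz, hb⟩ := exists_chain_of_walk p
  have hxy : z s(x, y) = 0 := by
    by_contra h'
    exact hp (hz _ h')
  refine (hg (z + Pi.single s(x, y) 1)
    (ChainOn.add (fun e he => p.edges_subset_edgeSet (hz e he)) (chainOn_single h)) ?_ ?_).trans ?_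
  · intro h0
    have := congrFun h0 s(x, y)
    simp [hxy] at this
  · rw [map_add, hb, chainBoundary_single h.ne, pi_zmod_two_add_self]
  · unfold hammingNorm
    calc _ ≤ (insert s(x, y) p.edges.toFinset).card := by
          refine Finset.card_le_card fun e he => ?_
          rw [Finset.mem_insert, List.mem_toFinset]
          by_cases h1 : e = s(x, y)
          · exact Or.inl h1
          · rw [Finset.mem_filter, Pi.add_apply, Pi.single_eq_of_ne h1, add_zero] at he
            exact Or.inr (hz e he.2)
      _ ≤ p.edges.toFinset.card + 1 := Finset.card_insert_le _ _
      _ ≤ p.length + 1 := by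
          have := p.edges.toFinset_card_le
          rw [Walk.length_edges] at this
          omega

/-- A vertex farther from the target than the start of a geodesic is not met by the geodesic. -/
theorem not_mem_support_of_dist_lt {W : Type*} {G : SimpleGraph W} {x y z : W} (p : G.Walk y z)
    (hp : p.length ≤ G.dist x z) (hxy : x ≠ y) : x ∉ p.support := by
  intro hx
  have h1 := congrArg Walk.length (p.take_spec hx)
  rw [Walk.length_append] at h1
  have h2 := dist_le (p.dropUntil x hx)
  have h3 : (p.takeUntil x hx).length ≠ 0 := fun h => hxy (Walk.eq_of_length_eq_zero h).symm
  omega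

/-- Equal distances would give two geodesics to `z` closing up with the edge `xy` to a closed walk
of length at most `2 * S + 1` that uses this edge once. -/
theorem CycleGirth.dist_ne_of_adj {G : SimpleGraph V} {S : ℕ} (hg : CycleGirth G (2 * S + 2))
    {x y z : V} (hxy : G.Adj x y) (hz : G.Reachable x z) (hS : G.dist x z ≤ S) :
    G.dist y z ≠ G.dist x z := by
  intro heq
  obtain ⟨p, hp⟩ := hz.exists_walk_length_eq_dist
  obtain ⟨q, hq⟩ := (hxy.symm.reachable.trans hz).exists_walk_length_eq_dist
  have h1 : y ∉ p.support := not_mem_support_of_dist_lt p (by omega) hxy.ne'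
  have h2 : x ∉ q.support := not_mem_support_of_dist_lt q (by omega) hxy.ne
  have := hg.le_length hxy (p.append q.reverse) (by
    rw [Walk.edges_append, List.mem_append, Walk.edges_reverse, List.mem_reverse]
    rintro (h | h)
    · exact h1 (p.snd_mem_support_of_mem_edges h)
    · exact h2 (q.fst_mem_support_of_mem_edges h))
  rw [Walk.length_append, Walk.length_reverse] at this
  omega

/-- Geodesics from two distinct nearer neighbours would join the ends of the edge `xy` by a short
walk avoiding it. -/
theorem CycleGirth.eq_of_dist_lt {G : SimpleGraph V} {S : ℕ} (hg : CycleGirth G (2 * S + 2))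
    {x y y' z : V} (hxy : G.Adj x y) (hxy' : G.Adj x y') (hz : G.Reachable x z)
    (hS : G.dist x z ≤ S) (hy : G.dist y z < G.dist x z) (hy' : G.dist y' z < G.dist x z) :
    y = y' := by
  by_contra hne
  obtain ⟨p, hp⟩ := (hxy.symm.reachable.trans hz).exists_walk_length_eq_dist
  obtain ⟨q, hq⟩ := (hxy'.symm.reachable.trans hz).exists_walk_length_eq_dist
  have h1 : x ∉ p.support := not_mem_support_of_dist_lt p (by omega) hxy.ne
  have h2 : x ∉ q.support := not_mem_support_of_dist_lt q (by omega) hxy'.ne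
  have := hg.le_length hxy (Walk.cons hxy' (q.append p.reverse)) (by
    rw [Walk.edges_cons, List.mem_cons, Walk.edges_append, List.mem_append, Walk.edges_reverse,
      List.mem_reverse]
    rintro (h | h | h)
    · exact hne (Sym2.congr_right.1 h)
    · exact h2 (q.fst_mem_support_of_mem_edges h)
    · exact h1 (p.fst_mem_support_of_mem_edges h))
  rw [Walk.length_cons, Walk.length_append, Walk.length_reverse] at this
  omega

end Chains

/-- There are finite cubic graphs of arbitrarily large girth. -/
theorem exists_cubic_cycleGirth (n : ℕ) : ∃ (V : Type) (_ : Fintype V) (_ : Nonempty V)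
    (G : SimpleGraph V), (∀ v, (G.neighborSet v).ncard = 3) ∧ CycleGirth G (n + 1) := by
  induction n with
  | zero =>
    refine ⟨Fin 4, inferInstance, inferInstance, ⊤, fun v => ?_, fun z _ hz _ => ?_⟩
    · rw [SimpleGraph.neighborSet_top, Set.ncard_compl, Set.ncard_singleton]
      simp
    · exact hammingNorm_pos_iff.2 hz
  | succ n ih =>
    obtain ⟨V, _, _, G, hG, hg⟩ := ih
    classical
    refine ⟨V × (Sym2 V → ZMod 2), inferInstance, inferInstance, homologyCover G,
      fun v => (ncard_neighborSet_homologyCover G v).trans (hG _), fun z hz hz0 hb => ?_⟩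
    -- Doubling suffices, as `2 * (n + 1) ≥ n + 2`.
    have := hg.homologyCover z hz hz0 (by convert hb)
    convert le_trans _ this using 1
    omega

theorem isCoarseEmbedding_of_bounds {X H : Type*} [MetricSpace X] [NormedAddCommGroup H]
    {f : X → H} (h₁ : ∀ B : ℝ, ∃ D : ℝ, ∀ x y, ‖f x - f y‖ ≤ B → dist x y ≤ D)
    (h₂ : ∀ D : ℝ, ∃ B : ℝ, ∀ x y, dist x y ≤ D → ‖f x - f y‖ ≤ B) : IsCoarseEmbedding f := by
  intro x y
  constructor
  · refine fun h => tendsto_atTop.2 fun B => ?_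
    obtain ⟨D, hD⟩ := h₁ B
    filter_upwards [h.eventually_gt_atTop D] with n hn
    by_contra hc
    exact absurd (hD _ _ (not_le.1 hc).le) (not_le.2 hn)
  · refine fun h => tendsto_atTop.2 fun D => ?_
    obtain ⟨B, hB⟩ := h₂ D
    filter_upwards [h.eventually_gt_atTop B] with n hn
    by_contra hc
    exact absurd (hB _ _ (not_le.1 hc).le) (not_le.2 hn)

/-- A disconnected graph whose components are bounded by a size function taking each value
finitely often, with a finite set of walls attached to each vertex. -/
structure SizedGraph (X I : Type*) where
  graph : SimpleGraph X
  size : X → ℕ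
  walls : X → Finset I
  one_le_size : ∀ a, 1 ≤ size a
  size_eq : ∀ {a b}, graph.Reachable a b → size a = size b
  dist_le_size : ∀ a b, graph.dist a b ≤ size a
  finite_size_le : ∀ k, {a | size a ≤ k}.Finite

namespace SizedGraph
open scoped Classical

/-! ### The metric on a union of components -/

section Metric
variable {X I : Type*} (Γ : SizedGraph X I)

/-- The path metric on components; distinct components are far apart. -/
noncomputable def natDist (a b : X) : ℕ :=
  if Γ.graph.Reachable a b then Γ.graph.dist a b else Γ.size a + Γ.size b

theorem natDist_of_reachable {a b : X} (h : Γ.graph.Reachable a b) :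
    Γ.natDist a b = Γ.graph.dist a b := if_pos h

theorem natDist_of_not_reachable {a b : X} (h : ¬ Γ.graph.Reachable a b) :
    Γ.natDist a b = Γ.size a + Γ.size b := if_neg h

theorem natDist_comm (a b : X) : Γ.natDist a b = Γ.natDist b a := by
  unfold natDist
  rw [SimpleGraph.reachable_comm, SimpleGraph.dist_comm, add_comm]

/-- Size is constant on components and bounds distances inside them, so a detour through another
component is never shorter. -/
theorem natDist_triangle (a b c : X) : Γ.natDist a c ≤ Γ.natDist a b + Γ.natDist b c := by
  by_cases hab : Γ.graph.Reachable a b <;> by_cases hbc : Γ.graph.Reachable b c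
  · rw [Γ.natDist_of_reachable hab, Γ.natDist_of_reachable hbc,
      Γ.natDist_of_reachable (hab.trans hbc)]
    exact hab.dist_triangle_left c
  · rw [Γ.natDist_of_not_reachable hbc,
      Γ.natDist_of_not_reachable fun h => hbc (hab.symm.trans h), Γ.size_eq hab]
    omega
  · rw [Γ.natDist_of_not_reachable hab,
      Γ.natDist_of_not_reachable fun h => hab (h.trans hbc.symm), Γ.size_eq hbc]
    omega
  · rw [Γ.natDist_of_not_reachable hab, Γ.natDist_of_not_reachable hbc]
    by_cases hac : Γ.graph.Reachable a c
    · rw [Γ.natDist_of_reachable hac]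
      have := Γ.dist_le_size a c
      omega
    · rw [Γ.natDist_of_not_reachable hac]
      omega

theorem natDist_eq_zero {a b : X} (h : Γ.natDist a b = 0) : a = b := by
  by_cases hab : Γ.graph.Reachable a b
  · rw [Γ.natDist_of_reachable hab] at h
    exact hab.dist_eq_zero_iff.1 h
  · rw [Γ.natDist_of_not_reachable hab] at h
    have := Γ.one_le_size a
    omega

/-- The metric space given by `natDist`. -/
@[reducible]
noncomputable def metricSpace : MetricSpace X where
  dist a b := Γ.natDist a b
  dist_self a := by
    rw [Γ.natDist_of_reachable (SimpleGraph.Reachable.refl a), SimpleGraph.dist_self, Nat.cast_zero]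
  dist_comm a b := by rw [Γ.natDist_comm]
  dist_triangle a b c := by exact_mod_cast Γ.natDist_triangle a b c
  eq_of_dist_eq_zero h := Γ.natDist_eq_zero (by exact_mod_cast h)

theorem dist_eq (a b : X) : @dist X Γ.metricSpace.toDist a b = Γ.natDist a b := rfl

theorem dist_le_iff (a b : X) {R : ℝ} (hR : 0 ≤ R) :
    @dist X Γ.metricSpace.toDist a b ≤ R ↔ Γ.natDist a b ≤ ⌊R⌋₊ := by
  rw [dist_eq, Nat.le_floor_iff hR]

theorem uniformlyDiscrete : @UniformlyDiscrete X Γ.metricSpace := by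
  refine ⟨1, one_pos, fun x y hxy => ?_⟩
  rw [dist_eq]
  exact_mod_cast Nat.one_le_iff_ne_zero.2 fun h => hxy (Γ.natDist_eq_zero h)

theorem exists_finset_of_walk_length_le {G : SimpleGraph X} {d : ℕ}
    (hdeg : ∀ x, (G.neighborSet x).Finite ∧ (G.neighborSet x).ncard ≤ d) (n : ℕ) :
    ∀ a, ∃ T : Finset X, T.card ≤ (d + 1) ^ n ∧
      ∀ b (p : G.Walk a b), p.length ≤ n → b ∈ T := by
  induction n with
  | zero =>
    refine fun a => ⟨{a}, by simp, fun b p hp => ?_⟩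
    rw [Finset.mem_singleton, SimpleGraph.Walk.eq_of_length_eq_zero (Nat.le_zero.1 hp)]
  | succ n ih =>
    intro a
    choose T hT hmem using ih
    refine ⟨(insert a (hdeg a).1.toFinset).biUnion T, ?_, fun b p hp => ?_⟩
    · refine (Finset.card_biUnion_le_card_mul _ _ _ fun x _ => hT x).trans ?_
      rw [pow_succ']
      gcongr
      refine (Finset.card_insert_le _ _).trans ?_
      have := (hdeg a).2
      rw [Set.ncard_eq_toFinset_card _ (hdeg a).1] at this
      omega
    · cases p with
      | nil => exact Finset.mem_biUnion.2 ⟨a, by simp, hmem a a SimpleGraph.Walk.nil (by simp)⟩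
      | @cons _ v _ h q =>
        refine Finset.mem_biUnion.2 ⟨v, by simpa using Or.inr h, hmem v b q ?_⟩
        rw [SimpleGraph.Walk.length_cons] at hp
        omega

/-- A ball consists of a ball of the graph, bounded through the degree, and points of other
components, whose size is at most the radius; the latter lie in a finite set independent of the
centre. -/
theorem boundedGeometry {d : ℕ} (hdeg : ∀ x, (Γ.graph.neighborSet x).Finite ∧
    (Γ.graph.neighborSet x).ncard ≤ d) : @BoundedGeometry X Γ.metricSpace := by
  intro R
  set U := (Γ.finite_size_le ⌊R⌋₊).toFinset with hU
  refine ⟨(d + 1) ^ ⌊R⌋₊ + U.card, fun x => ?_⟩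
  obtain ⟨T, hT, hmem⟩ := exists_finset_of_walk_length_le hdeg ⌊R⌋₊ x
  have hsub : @Metric.closedBall X Γ.metricSpace.toPseudoMetricSpace x R ⊆
      ((T ∪ U : Finset X) : Set X) := by
    intro b hb
    have hb' : @dist X Γ.metricSpace.toDist b x ≤ R := hb
    have hR : 0 ≤ R := le_trans (by rw [dist_eq]; positivity) hb'
    rw [Γ.dist_le_iff _ _ hR, Γ.natDist_comm] at hb'
    rw [Finset.coe_union]
    by_cases h : Γ.graph.Reachable x b
    · obtain ⟨p, hp⟩ := h.exists_walk_length_eq_dist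
      rw [Γ.natDist_of_reachable h] at hb'
      exact Or.inl (hmem b p (hp.trans_le hb'))
    · rw [Γ.natDist_of_not_reachable h] at hb'
      refine Or.inr ?_
      simp only [hU, Set.Finite.coe_toFinset, Set.mem_ofPred_eq]
      omega
  refine ⟨(Finset.finite_toSet _).subset hsub, ?_⟩
  refine (Set.ncard_le_ncard hsub (Finset.finite_toSet _)).trans ?_
  rw [Set.ncard_coe_finset]
  exact (Finset.card_union_le _ _).trans (by omega)

end Metric

/-! ### The wall embedding -/

section Embedding
variable {X I : Type} (Γ : SizedGraph X I)

/-- The coordinates of a vertex: its size at its component, and the indicator of its walls. -/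
noncomputable def coord (a : X) : Γ.graph.ConnectedComponent ⊕ I → ℝ :=
  Sum.elim (fun C => if C = Γ.graph.connectedComponentMk a then (Γ.size a : ℝ) else 0)
    (fun i => if i ∈ Γ.walls a then 1 else 0)

theorem memℓp_coord (a : X) : Memℓp (Γ.coord a) 2 := by
  refine (memℓp_zero (Set.Finite.subset (Finset.finite_toSet
    (insert (Sum.inl (Γ.graph.connectedComponentMk a)) ((Γ.walls a).map ⟨Sum.inr, Sum.inr_injective⟩)))
    ?_)).of_exponent_ge zero_le
  rintro (C | i) h
  · have : C = Γ.graph.connectedComponentMk a := by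
      by_contra hC
      exact h (by simp [coord, hC])
    simp [this]
  · have : i ∈ Γ.walls a := by
      by_contra hC
      exact h (by simp [coord, hC])
    simp [this]

/-- The embedding into `ℓ²`. -/
noncomputable def embed (a : X) : lp (fun _ : Γ.graph.ConnectedComponent ⊕ I => ℝ) 2 :=
  ⟨Γ.coord a, Γ.memℓp_coord a⟩

theorem norm_embed_sub_sq {a b : X} (h : Γ.graph.Reachable a b) :
    ‖Γ.embed a - Γ.embed b‖ ^ 2 = ((symmDiff (Γ.walls a) (Γ.walls b)).card : ℝ) := by
  have h2 : (0 : ℝ) < (2 : ENNReal).toReal := by norm_num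
  have := lp.norm_rpow_eq_tsum h2 (Γ.embed a - Γ.embed b)
  simp only [ENNReal.toReal_ofNat, Real.rpow_ofNat] at this
  rw [this, tsum_eq_sum (s := (symmDiff (Γ.walls a) (Γ.walls b)).map ⟨Sum.inr, Sum.inr_injective⟩),
    Finset.sum_map, Finset.cast_card]
  · refine Finset.sum_congr rfl fun i hi => ?_
    change ‖Γ.coord a (Sum.inr i) - Γ.coord b (Sum.inr i)‖ ^ 2 = 1
    rcases Finset.mem_symmDiff.1 hi with ⟨h1, h2⟩ | ⟨h1, h2⟩ <;> simp [coord, h1, h2]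
  · rintro (C | i) hi
    · change ‖Γ.coord a (Sum.inl C) - Γ.coord b (Sum.inl C)‖ ^ 2 = 0
      simp [coord, SimpleGraph.ConnectedComponent.eq.2 h, Γ.size_eq h]
    · change ‖Γ.coord a (Sum.inr i) - Γ.coord b (Sum.inr i)‖ ^ 2 = 0
      have : i ∉ symmDiff (Γ.walls a) (Γ.walls b) := fun h' => hi (by simpa using h')
      rw [Finset.mem_symmDiff] at this
      by_cases h1 : i ∈ Γ.walls a <;> by_cases h2 : i ∈ Γ.walls b <;> simp_all [coord]

theorem size_le_norm_embed_sub {a b : X} (h : ¬ Γ.graph.Reachable a b) :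
    (Γ.size a : ℝ) ≤ ‖Γ.embed a - Γ.embed b‖ := by
  refine le_trans ?_ (lp.norm_apply_le_norm two_ne_zero (Γ.embed a - Γ.embed b)
    (Sum.inl (Γ.graph.connectedComponentMk a)))
  change _ ≤ ‖Γ.coord a (Sum.inl _) - Γ.coord b (Sum.inl _)‖
  simp [coord, SimpleGraph.ConnectedComponent.eq, h]

/-- Walls control distances inside a component, apart from finitely many points for each bound `r`;
the size coordinates separate components. -/
theorem coarselyEmbeds
    (hle : ∀ a b, Γ.graph.Reachable a b →
      (symmDiff (Γ.walls a) (Γ.walls b)).card ≤ Γ.graph.dist a b)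
    (hge : ∀ r, {a | ∃ b, Γ.graph.Reachable a b ∧ (symmDiff (Γ.walls a) (Γ.walls b)).card ≤ r ∧
      r < Γ.graph.dist a b}.Finite) :
    @CoarselyEmbedsIntoHilbert X Γ.metricSpace := by
  let := Γ.metricSpace
  refine ⟨lp (fun _ : Γ.graph.ConnectedComponent ⊕ I => ℝ) 2, inferInstance, inferInstance,
    inferInstance, Γ.embed, isCoarseEmbedding_of_bounds (fun B => ?_) fun D => ?_⟩
  · set r := ⌊B ^ 2⌋₊ with hr
    -- `2 * B` serves distinct components, whose sizes are at most `B`; the sum of sizes bounds the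
    -- distances from exceptional points.
    refine ⟨max (2 * B) (max r (∑ u ∈ (hge r).toFinset, Γ.size u : ℕ)), fun a b hab => ?_⟩
    rw [dist_eq]
    by_cases h : Γ.graph.Reachable a b
    · rw [Γ.natDist_of_reachable h]
      refine le_max_of_le_right ?_
      have hcard : (symmDiff (Γ.walls a) (Γ.walls b)).card ≤ r := by
        rw [hr]
        apply Nat.le_floor
        rw [← Γ.norm_embed_sub_sq h]
        gcongr
      by_cases hd : Γ.graph.dist a b ≤ r
      · exact le_max_of_le_left (by exact_mod_cast hd)
      · refine le_max_of_le_right ?_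
        have ha : a ∈ (hge r).toFinset :=
          (Set.Finite.mem_toFinset _).2 ⟨b, h, hcard, not_le.1 hd⟩
        exact_mod_cast (Γ.dist_le_size a b).trans
          (Finset.single_le_sum (f := Γ.size) (fun _ _ => Nat.zero_le _) ha)
    · rw [Γ.natDist_of_not_reachable h]
      refine le_max_of_le_left ?_
      have h1 := Γ.size_le_norm_embed_sub h
      have h2 := Γ.size_le_norm_embed_sub fun h' => h h'.symm
      rw [norm_sub_rev] at h2
      push_cast
      linarith
  · set U := (Γ.finite_size_le ⌊D⌋₊).toFinset with hU
    -- In one component the squared norm is at most `D`, hence the norm is at most `D + 1`. Points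
    -- of distinct components within `D` both lie in the finite set `U`.
    refine ⟨max (D + 1) (2 * ∑ u ∈ U, ‖Γ.embed u‖), fun a b hab => ?_⟩
    have hD : 0 ≤ D := dist_nonneg.trans hab
    by_cases h : Γ.graph.Reachable a b
    · refine le_max_of_le_left ?_
      rw [dist_eq, Γ.natDist_of_reachable h] at hab
      have h1 := Γ.norm_embed_sub_sq h
      have h2 : ((symmDiff (Γ.walls a) (Γ.walls b)).card : ℝ) ≤ Γ.graph.dist a b := by
        exact_mod_cast hle a b h
      nlinarith [norm_nonneg (Γ.embed a - Γ.embed b)]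
    · refine le_max_of_le_right ?_
      rw [Γ.dist_le_iff _ _ hD, Γ.natDist_of_not_reachable h] at hab
      have hmem : ∀ u, Γ.size u ≤ ⌊D⌋₊ → ‖Γ.embed u‖ ≤ ∑ u ∈ U, ‖Γ.embed u‖ := fun u hu =>
        Finset.single_le_sum (f := fun u => ‖Γ.embed u‖) (fun _ _ => norm_nonneg _)
          ((Set.Finite.mem_toFinset _).2 hu)
      have h1 := hmem a (by omega)
      have h2 := hmem b (by omega)
      have h3 := norm_sub_le (Γ.embed a) (Γ.embed b)
      linarith

end Embedding

/-! ### Failure of property A by double counting -/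

section PropertyA
variable {X I : Type*} (Γ : SizedGraph X I)

/-- At scale `S`, the cubic graph `G` looks like a tree along the finite set `F`. -/
structure TreelikeOn (G : SimpleGraph X) (S : ℕ) (F : Finset X) : Prop where
  nonempty : F.Nonempty
  mem_of_adj : ∀ x ∈ F, ∀ y, G.Adj x y → y ∈ F
  ncard_neighborSet : ∀ x ∈ F, (G.neighborSet x).ncard = 3
  dist_ne : ∀ x ∈ F, ∀ y z, G.Adj x y → G.Reachable x z → G.dist x z ≤ S →
    G.dist y z ≠ G.dist x z
  eq_of_dist_lt : ∀ x ∈ F, ∀ y y' z, G.Adj x y → G.Adj x y' → G.Reachable x z →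
    G.dist x z ≤ S → G.dist y z < G.dist x z → G.dist y' z < G.dist x z → y = y'

/-- Each point of `A x` votes for the neighbour of `x` nearer to it, if any. Treelikeness allows at
most one vote, and each common point of `A x` and `A y` votes across the edge `xy` from one end.
With `ε = 1 / 4` the vote shares across an edge total at least 4/5, so summing over `F` gives `12 /
5 * |F| ≤ 2 * |F|`. -/
theorem not_propertyA (h : ∀ S : ℕ, ∃ F, TreelikeOn Γ.graph S F ∧ ∀ x ∈ F, S < Γ.size x) :
    ¬ @PropertyA X Γ.metricSpace := by
  intro hA
  obtain ⟨A, S, hS, hAR, hAS⟩ := hA (1 / 4) (by norm_num) 1 one_pos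
  obtain ⟨F, hF, hsize⟩ := h ⌊S⌋₊
  set G := Γ.graph with hG
  -- Size above `S` keeps `A x` inside the component of `x`.
  have hreach : ∀ x ∈ F, ∀ t ∈ A x, G.Reachable x t.1 ∧ G.dist x t.1 ≤ ⌊S⌋₊ := by
    intro x hx t ht
    have h1 := hAS x t ht
    rw [Γ.dist_le_iff _ _ hS.le, Γ.natDist_comm] at h1
    have h2 := hsize x hx
    by_cases hr : G.Reachable x t.1
    · rw [Γ.natDist_of_reachable hr] at h1
      exact ⟨hr, h1⟩
    · rw [Γ.natDist_of_not_reachable hr] at h1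
      omega
  have hpos : ∀ x, 0 < ((A x).card : ℝ) := by
    intro x
    have h1 := hAR x x (by
      rw [dist_eq, Γ.natDist_of_reachable (SimpleGraph.Reachable.refl x), SimpleGraph.dist_self]
      norm_num)
    rw [symmDiff_self, Finset.inter_self] at h1
    simp only [Finset.bot_eq_empty, Finset.card_empty, Nat.cast_zero] at h1
    linarith
  let T : X → X → Finset (X × ℕ) := fun x y => (A x).filter fun t => G.dist y t.1 < G.dist x t.1
  let P : X → X → ℝ := fun x y => (T x y).card / (A x).card
  have hsum : ∀ x ∈ F, ∑ y ∈ F, (if G.Adj x y then P x y else 0) ≤ 1 := by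
    intro x hx
    rw [← Finset.sum_filter, ← Finset.sum_div, div_le_one (hpos x)]
    norm_cast
    simp only [T, Finset.card_filter]
    rw [Finset.sum_comm, Finset.card_eq_sum_ones]
    refine Finset.sum_le_sum fun t ht => ?_
    rw [← Finset.card_filter]
    refine Finset.card_le_one.2 fun y hy y' hy' => ?_
    simp only [Finset.mem_filter] at hy hy'
    exact hF.eq_of_dist_lt x hx y y' t.1 hy.1.2 hy'.1.2 (hreach x hx t ht).1 (hreach x hx t ht).2
      hy.2 hy'.2
  have hedge : ∀ x ∈ F, ∀ y ∈ F, G.Adj x y → 4 / 5 ≤ P x y + P y x := by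
    intro x hx y hy hxy
    have h1 := hAR x y (by
      rw [dist_eq, Γ.natDist_of_reachable hxy.reachable, SimpleGraph.dist_eq_one_iff_adj.2 hxy]
      norm_num)
    have hcov : ((A x ∩ A y).card : ℝ) ≤ (T x y).card + (T y x).card := by
      norm_cast
      refine (Finset.card_le_card fun t ht => ?_).trans (Finset.card_union_le _ _)
      obtain ⟨htx, hty⟩ := Finset.mem_inter.1 ht
      simp only [T, Finset.mem_union, Finset.mem_filter, htx, hty, true_and]
      exact lt_or_gt_of_ne (hF.dist_ne x hx y t.1 hxy (hreach x hx t htx).1 (hreach x hx t htx).2)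
    have hle : ∀ B C : Finset (X × ℕ), (B.card : ℝ) ≤ (B ∩ C).card + (symmDiff B C).card := by
      intro B C
      norm_cast
      refine (Finset.card_le_card fun t ht => ?_).trans (Finset.card_union_le _ _)
      by_cases htC : t ∈ C <;> simp [Finset.mem_symmDiff, ht, htC]
    have hx1 := hle (A x) (A y)
    have hy1 := hle (A y) (A x)
    rw [Finset.inter_comm, symmDiff_comm] at hy1
    set m : ℝ := ((A x ∩ A y).card : ℝ)
    -- Both `A x` and `A y` have at most `5 / 4 * m` points, since their symmetric difference has
    -- fewer than `m / 4`.
    have hm : 0 < 5 / 4 * m := lt_of_lt_of_le (hpos x) (by linarith)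
    calc 4 / 5 ≤ ((T x y).card + (T y x).card : ℝ) / (5 / 4 * m) := by
          rw [le_div_iff₀ hm]; linarith
      _ = (T x y).card / (5 / 4 * m) + (T y x).card / (5 / 4 * m) := add_div _ _ _
      _ ≤ P x y + P y x := by
          have := hpos x
          have := hpos y
          simp only [P]
          gcongr <;> linarith
  have hdeg : ∀ x ∈ F, ∑ y ∈ F, (if G.Adj x y then (4 / 5 : ℝ) else 0) = 12 / 5 := by
    intro x hx
    have h1 : ((F.filter (G.Adj x) : Finset X) : Set X) = G.neighborSet x := by
      ext y
      simp only [Finset.coe_filter, Set.mem_ofPred_eq, SimpleGraph.mem_neighborSet]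
      exact ⟨fun h => h.2, fun h => ⟨hF.mem_of_adj x hx y h, h⟩⟩
    have h2 : (F.filter (G.Adj x)).card = 3 := by
      rw [← Set.ncard_coe_finset, h1, hF.ncard_neighborSet x hx]
    rw [← Finset.sum_filter, Finset.sum_const, h2]
    norm_num
  have htot : ∑ x ∈ F, ∑ y ∈ F, (if G.Adj x y then (4 / 5 : ℝ) else 0) ≤
      ∑ x ∈ F, ∑ y ∈ F, (if G.Adj x y then P x y else 0) +
      ∑ x ∈ F, ∑ y ∈ F, (if G.Adj x y then P x y else 0) := by
    have hswap : ∑ x ∈ F, ∑ y ∈ F, (if G.Adj x y then P x y else 0) =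
        ∑ x ∈ F, ∑ y ∈ F, (if G.Adj x y then P y x else 0) := by
      rw [Finset.sum_comm]
      simp only [G.adj_comm]
    nth_rewrite 2 [hswap]
    rw [← Finset.sum_add_distrib]
    refine Finset.sum_le_sum fun x hx => ?_
    rw [← Finset.sum_add_distrib]
    refine Finset.sum_le_sum fun y hy => ?_
    split_ifs with hxy
    · exact hedge x hx y hy hxy
    · simp
  rw [Finset.sum_congr rfl hdeg, Finset.sum_const, nsmul_eq_mul] at htot
  have h1 := Finset.sum_le_sum hsum
  rw [Finset.sum_const, nsmul_eq_mul, mul_one] at h1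
  have h2 : (0 : ℝ) < F.card := by exact_mod_cast hF.nonempty.card_pos
  linarith

end PropertyA

end SizedGraph

/-! ### Disjoint unions of graphs -/

section Sigma
open SimpleGraph

variable {ι : Type*} {V : ι → Type*}

/-- The disjoint union of a family of graphs. -/
def sigmaGraph (G : ∀ i, SimpleGraph (V i)) : SimpleGraph (Σ i, V i) where
  Adj a b := ∃ i x y, (G i).Adj x y ∧ a = ⟨i, x⟩ ∧ b = ⟨i, y⟩
  symm := ⟨fun _ _ ⟨i, x, y, h, ha, hb⟩ => ⟨i, y, x, h.symm, hb, ha⟩⟩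
  loopless := ⟨by
    rintro _ ⟨i, x, y, h, rfl, hb⟩
    obtain rfl : x = y := by simpa using hb
    exact h.ne rfl⟩

variable {G : ∀ i, SimpleGraph (V i)}

theorem sigmaGraph_adj_mk {i : ι} {x : V i} {b : Σ i, V i} :
    (sigmaGraph G).Adj ⟨i, x⟩ b ↔ ∃ y, b = ⟨i, y⟩ ∧ (G i).Adj x y := by
  constructor
  · rintro ⟨j, x', y, h, ha, rfl⟩
    obtain ⟨rfl, hx⟩ := Sigma.mk.inj_iff.1 ha
    obtain rfl := eq_of_heq hx
    exact ⟨y, rfl, h⟩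
  · rintro ⟨y, rfl, h⟩
    exact ⟨i, x, y, h, rfl, rfl⟩

theorem exists_sigma_walk {i : ι} {x y : V i} (p : (G i).Walk x y) :
    ∃ q : (sigmaGraph G).Walk ⟨i, x⟩ ⟨i, y⟩, q.length = p.length :=
  ⟨p.map (⟨Sigma.mk i, fun {a b} h => ⟨i, a, b, h, rfl, rfl⟩⟩ : G i →g sigmaGraph G), by simp⟩

theorem exists_walk_of_sigma {a b : Σ i, V i} (p : (sigmaGraph G).Walk a b) :
    ∀ (i : ι) (x : V i), a = ⟨i, x⟩ → ∃ y, b = ⟨i, y⟩ ∧ ∃ q : (G i).Walk x y, q.length = p.length := by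
  induction p with
  | nil => exact fun i x h => ⟨x, h, Walk.nil, rfl⟩
  | cons h p ih =>
    rintro i x rfl
    obtain ⟨y, rfl, hy⟩ := sigmaGraph_adj_mk.1 h
    obtain ⟨z, rfl, q, hq⟩ := ih i y rfl
    exact ⟨z, rfl, Walk.cons hy q, by simp [hq]⟩

theorem sigmaGraph_reachable_mk {i : ι} {x : V i} {b : Σ i, V i} :
    (sigmaGraph G).Reachable ⟨i, x⟩ b ↔ ∃ y, b = ⟨i, y⟩ ∧ (G i).Reachable x y := by
  constructor
  · rintro ⟨p⟩
    obtain ⟨y, hb, q, -⟩ := exists_walk_of_sigma p i x rfl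
    exact ⟨y, hb, ⟨q⟩⟩
  · rintro ⟨y, rfl, ⟨p⟩⟩
    exact ⟨(exists_sigma_walk p).choose⟩

theorem sigmaGraph_dist_mk {i : ι} {x y : V i} :
    (sigmaGraph G).dist ⟨i, x⟩ ⟨i, y⟩ = (G i).dist x y := by
  by_cases h : (G i).Reachable x y
  · apply le_antisymm
    · obtain ⟨p, hp⟩ := h.exists_walk_length_eq_dist
      obtain ⟨q, hq⟩ := exists_sigma_walk p
      rw [← hp, ← hq]
      exact dist_le q
    · obtain ⟨p, hp⟩ :=
        (sigmaGraph_reachable_mk.2 ⟨y, rfl, h⟩ :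
          (sigmaGraph G).Reachable ⟨i, x⟩ ⟨i, y⟩).exists_walk_length_eq_dist
      obtain ⟨y', hy, q, hq⟩ := exists_walk_of_sigma p i x rfl
      obtain rfl : y = y' := by simpa using hy
      rw [← hp, ← hq]
      exact dist_le q
  · rw [dist_eq_zero_of_not_reachable h, dist_eq_zero_of_not_reachable]
    intro h'
    obtain ⟨y', hy, hr⟩ := sigmaGraph_reachable_mk.1 h'
    obtain rfl : y = y' := by simpa using hy
    exact h hr

theorem sigmaGraph_neighborSet_mk {i : ι} {x : V i} :
    (sigmaGraph G).neighborSet ⟨i, x⟩ = (fun y => (⟨i, y⟩ : Σ i, V i)) '' (G i).neighborSet x := by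
  ext b
  rw [mem_neighborSet, sigmaGraph_adj_mk, Set.mem_image]
  constructor
  · rintro ⟨y, rfl, h⟩
    exact ⟨y, h, rfl⟩
  · rintro ⟨y, h, rfl⟩
    exact ⟨y, rfl, h⟩

theorem ncard_neighborSet_sigmaGraph {i : ι} {x : V i} :
    ((sigmaGraph G).neighborSet ⟨i, x⟩).ncard = ((G i).neighborSet x).ncard := by
  rw [sigmaGraph_neighborSet_mk]
  exact Set.ncard_image_of_injective _ sigma_mk_injective

theorem finite_sigma_fst_le {V : ℕ → Type*} [∀ n, Finite (V n)] (k : ℕ) :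
    {a : Σ n, V n | a.1 ≤ k}.Finite := by
  refine ((Set.finite_Iic k).biUnion fun n _ => Set.finite_range (Sigma.mk n : V n → Σ n, V n)).subset ?_
  rintro ⟨n, x⟩ h
  exact Set.mem_biUnion (x := n) h ⟨x, rfl⟩

end Sigma

/-! ### The union of the homology covers -/

section CoverSpace
open scoped Classical
open SimpleGraph

variable {V : ℕ → Type} [∀ n, Fintype (V n)] (G : ∀ n, SimpleGraph (V n))

/-- The disjoint union of the homology covers of a sequence of finite graphs. The walls of a vertex
are the edges of the base traversed an odd number of times on the way to it. -/
noncomputable def coverSpace :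
    SizedGraph (Σ n, V n × (Sym2 (V n) → ZMod 2)) (Σ n, Sym2 (V n)) where
  graph := sigmaGraph fun n => homologyCover (G n)
  -- The sum of all distances crudely bounds the diameter of each component; `a.1 + 1` makes sizes
  -- positive and tend to infinity.
  size a := a.1 + 1 + ∑ p : (V a.1 × (Sym2 (V a.1) → ZMod 2)) × (V a.1 × (Sym2 (V a.1) → ZMod 2)),
    (homologyCover (G a.1)).dist p.1 p.2
  walls a := (Finset.univ.filter fun e => a.2.2 e ≠ 0).map ⟨Sigma.mk a.1, sigma_mk_injective⟩
  one_le_size a := by omega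
  size_eq {a b} h := by
    obtain ⟨n, x⟩ := a
    obtain ⟨y, rfl, -⟩ := sigmaGraph_reachable_mk.1 h
    rfl
  dist_le_size a b := by
    obtain ⟨n, x⟩ := a
    by_cases h : (sigmaGraph fun n => homologyCover (G n)).Reachable ⟨n, x⟩ b
    · obtain ⟨y, rfl, -⟩ := sigmaGraph_reachable_mk.1 h
      rw [sigmaGraph_dist_mk]
      exact le_add_left (Finset.single_le_sum (f := fun p : (V n × (Sym2 (V n) → ZMod 2)) ×
        (V n × (Sym2 (V n) → ZMod 2)) => (homologyCover (G n)).dist p.1 p.2)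
        (fun _ _ => Nat.zero_le _) (Finset.mem_univ (x, y)))
    · rw [dist_eq_zero_of_not_reachable h]
      exact Nat.zero_le _
  finite_size_le k := (finite_sigma_fst_le k).subset fun a ha => by
    rw [Set.mem_ofPred_eq] at ha ⊢
    omega

theorem card_symmDiff_walls_coverSpace [DecidableEq (Σ n, Sym2 (V n))] (n : ℕ) (x y : V n × (Sym2 (V n) → ZMod 2)) :
    (symmDiff ((coverSpace G).walls ⟨n, x⟩) ((coverSpace G).walls ⟨n, y⟩)).card =
      hammingDist x.2 y.2 := by
  simp only [coverSpace]
  rw [Finset.map_eq_image, Finset.map_eq_image, Function.Embedding.coeFn_mk,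
    ← Finset.image_symmDiff _ _ sigma_mk_injective, Finset.card_image_of_injective _ sigma_mk_injective]
  unfold hammingDist
  congr 1
  ext e
  simp only [Finset.mem_symmDiff, Finset.mem_filter, Finset.mem_univ, true_and]
  generalize x.2 e = s
  generalize y.2 e = t
  revert s t
  decide

theorem coarselyEmbeds_coverSpace (hg : ∀ n, CycleGirth (G n) (n + 1)) :
    @CoarselyEmbedsIntoHilbert _ (coverSpace G).metricSpace := by
  refine SizedGraph.coarselyEmbeds _ ?_ fun r => ?_
  · rintro ⟨n, x⟩ b h
    obtain ⟨y, rfl, hr⟩ := sigmaGraph_reachable_mk.1 h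
    rw [card_symmDiff_walls_coverSpace]
    refine le_of_le_of_eq ?_ sigmaGraph_dist_mk.symm
    obtain ⟨p, hp⟩ := hr.exists_walk_length_eq_dist
    exact hp ▸ hammingDist_le_length p
  -- For `n > r` a wall distance of at most `r` is below the girth and equals the graph distance, so
  -- only indices `n ≤ r` are exceptional.
  · refine (finite_sigma_fst_le r).subset ?_
    rintro ⟨n, x⟩ ⟨b, h, hw, hd⟩
    by_contra hn
    replace hn : r < n := not_le.1 hn
    obtain ⟨y, rfl, ⟨p⟩⟩ := sigmaGraph_reachable_mk.1 h
    rw [card_symmDiff_walls_coverSpace] at hw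
    replace hd : r < (homologyCover (G n)).dist x y := lt_of_lt_of_eq hd sigmaGraph_dist_mk
    have hxy : hammingNorm (x.2 + y.2) = hammingDist x.2 y.2 := by
      rw [hammingDist_eq_hammingNorm]
      congr 1
      ext e
      rw [Pi.add_apply, Pi.add_apply, Pi.neg_apply, CharTwo.neg_eq]
    obtain ⟨hc, hb⟩ := chain_of_walk p
    obtain ⟨q, hq⟩ := exists_walk_of_hammingNorm_lt (hg n) _ x y hc hb rfl (by omega)
    have := dist_le q
    omega

theorem exists_treelikeOn_coverSpace [∀ n, Nonempty (V n)]
    (hdeg : ∀ n v, ((G n).neighborSet v).ncard = 3) (hg : ∀ n, CycleGirth (G n) (n + 1)) (S : ℕ) :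
    ∃ F, SizedGraph.TreelikeOn (coverSpace G).graph S F ∧ ∀ x ∈ F, S < (coverSpace G).size x := by
  -- The base of index `S` has girth bound `S + 1`, which doubles to exactly what treelikeness at
  -- scale `S` uses.
  have hcov : CycleGirth (homologyCover (G S)) (2 * S + 2) := (hg S).homologyCover
  refine ⟨Finset.univ.map ⟨Sigma.mk S, sigma_mk_injective⟩, ⟨by simp, ?_, ?_, ?_, ?_⟩, ?_⟩
  all_goals
    intro a ha
    obtain ⟨x, -, rfl⟩ := Finset.mem_map.1 ha
  · intro b h
    obtain ⟨y, rfl, -⟩ := sigmaGraph_adj_mk.1 h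
    simp
  · exact ncard_neighborSet_sigmaGraph.trans
      ((ncard_neighborSet_homologyCover _ _).trans (hdeg _ _))
  · intro b c hb hc
    obtain ⟨y, rfl, hy⟩ := sigmaGraph_adj_mk.1 hb
    obtain ⟨z, rfl, hz⟩ := sigmaGraph_reachable_mk.1 hc
    let Γ := sigmaGraph fun n => homologyCover (G n)
    change Γ.dist ⟨S, x⟩ _ ≤ S → Γ.dist ⟨S, y⟩ _ ≠
      Γ.dist ⟨S, x⟩ _
    simp only [Γ, sigmaGraph_dist_mk]
    exact hcov.dist_ne_of_adj hy hz
  · intro b b' c hb hb' hc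
    obtain ⟨y, rfl, hy⟩ := sigmaGraph_adj_mk.1 hb
    obtain ⟨y', rfl, hy'⟩ := sigmaGraph_adj_mk.1 hb'
    obtain ⟨z, rfl, hz⟩ := sigmaGraph_reachable_mk.1 hc
    let Γ := sigmaGraph fun n => homologyCover (G n)
    change Γ.dist ⟨S, x⟩ _ ≤ S → Γ.dist ⟨S, y⟩ _ <
      Γ.dist ⟨S, x⟩ _ → Γ.dist ⟨S, y'⟩ _ <
      Γ.dist ⟨S, x⟩ _ → _
    simp only [Γ, sigmaGraph_dist_mk]
    intro h1 h2 h3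
    rw [hcov.eq_of_dist_lt hy hy' hz h1 h2 h3]
  · simp only [coverSpace, Function.Embedding.coeFn_mk]
    omega

end CoverSpace

theorem theorem1p1 :
    ∃ (X : Type) (_ : MetricSpace X),
      UniformlyDiscrete X ∧ BoundedGeometry X ∧ CoarselyEmbedsIntoHilbert X ∧ ¬ PropertyA X := by
  choose V _ _ G hdeg hg using exists_cubic_cycleGirth
  refine ⟨_, (coverSpace G).metricSpace, SizedGraph.uniformlyDiscrete _,
    SizedGraph.boundedGeometry _ (d := 3) ?_, coarselyEmbeds_coverSpace G hg,
    SizedGraph.not_propertyA _ (exists_treelikeOn_coverSpace G hdeg hg)⟩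
  rintro ⟨n, x⟩
  have h : ((coverSpace G).graph.neighborSet ⟨n, x⟩).ncard = 3 :=
    ncard_neighborSet_sigmaGraph.trans ((ncard_neighborSet_homologyCover _ _).trans (hdeg _ _))
  exact ⟨Set.finite_of_ncard_ne_zero (by omega), h.le⟩
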